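/- Let $E$ be a (real) Banach lattice with topological dual $E'$ and positive cones $E^+$, $(E')^+$. For $\mathcal S\subset E$ let $sol(\mathcal S)=\{x\in E:\exists y\in \mathcal S,\ |x|\le |y|\}$. A norm bounded set $\mathcal S\subset E$ is called L-weakly compact if $\|x_n\|\to 0$ for every disjoint sequence $(x_n)$ in $sol(\mathcal S)$. A net $(x_\alpha)$ in $E$ is uaw-convergent to $x\in E$, written $x_\alpha\overset{uaw}\longrightarrow x$, if $|x_\alpha-x|\wedge u\to 0$ weakly for every $u\in E^+$. A set $A\subset E$ is uaw-compact (resp. relatively uaw-compact) if every net in $A$ has a subnet that is uaw-convergent to a point of $A$ (resp. to a point of $E$). For a norm bounded subset $\mathcal S$ of $E$, the following statements are equivalent: 1. $\mathcal S$ is L-weakly compact. 2. For each $\varepsilon>0$ there exist $g\in (E')^+$ and $u\in E^+$ such that $\|x\|\le g(|x|\wedge u)+\varepsilon$ for every $x\in sol(\mathcal S)$. 3. For every net $(x_\alpha)\subset sol(\mathcal S)$ such that $x_\alpha\overset{uaw}\longrightarrow 0$, we have $\|x_\alpha\|\to 0$. 4. Every norm bounded uaw-compact subset $A\subset sol(\mathcal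 S)$ is norm compact. 5. Every norm bounded relatively uaw-compact subset $A\subset sol(\mathcal S)$ is relatively norm compact. -/

import Mathlib

open Filter Topology

universe u v

/-- `UawTendsto l x a`: the family `x` converges to `a` along the filter `l` in the unbounded
absolute weak sense, i.e. `|x i - a| ⊓ u` tends to `0` in the weak topology of `E` for every
`u ≥ 0`. For a net indexed by a directed set, `l` is `atTop`. -/
def UawTendsto {E : Type u} [NormedAddCommGroup E] [NormedSpace ℝ E] [Lattice E]
    {ι : Type v} (l : Filter ι) (x : ι → E) (a : E) : Prop :=
  ∀ u : E, 0 ≤ u → Tendsto (fun i => toWeakSpace ℝ E (|x i - a| ⊓ u)) l (𝓝 0)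

/-- `A` is uaw-compact: every net in `A` has a subnet that is uaw-convergent to a point of `A`.
A subnet of `x : ι → E` is `x ∘ φ`, where `φ : κ → ι` is defined on a directed set `κ` and
is eventually above every given index. Index sets in the universe of `E` suffice to describe
compactness in the uaw-topology. -/
def IsUawCompact {E : Type u} [NormedAddCommGroup E] [NormedSpace ℝ E] [Lattice E]
    (A : Set E) : Prop :=
  ∀ (ι : Type u) [Preorder ι] [IsDirectedOrder ι] [Nonempty ι] (x : ι → E), (∀ i, x i ∈ A) →
    ∃ (κ : Type u) (_ : Preorder κ) (_ : IsDirectedOrder κ) (_ : Nonempty κ) (φ : κ → ι),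
      Tendsto φ atTop atTop ∧ ∃ a ∈ A, UawTendsto atTop (x ∘ φ) a

/-- `A` is relatively uaw-compact: every net in `A` has a subnet that is uaw-convergent to some
point of `E`. -/
def IsRelativelyUawCompact {E : Type u} [NormedAddCommGroup E] [NormedSpace ℝ E] [Lattice E]
    (A : Set E) : Prop :=
  ∀ (ι : Type u) [Preorder ι] [IsDirectedOrder ι] [Nonempty ι] (x : ι → E), (∀ i, x i ∈ A) →
    ∃ (κ : Type u) (_ : Preorder κ) (_ : IsDirectedOrder κ) (_ : Nonempty κ) (φ : κ → ι),
      Tendsto φ atTop atTop ∧ ∃ a : E, UawTendsto atTop (x ∘ φ) a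

/-- `S` is L-weakly compact: it is norm bounded and every disjoint sequence in its solid hull
`{x | ∃ y ∈ S, |x| ≤ |y|}` converges to `0` in norm. -/
def IsLWeaklyCompact {E : Type u} [NormedAddCommGroup E] [Lattice E] (S : Set E) : Prop :=
  Bornology.IsBounded S ∧
    ∀ x : ℕ → E, (∀ n, x n ∈ LatticeOrderedAddCommGroup.solidClosure S) →
      (∀ m n, m ≠ n → |x m| ⊓ |x n| = 0) → Tendsto (fun n => ‖x n‖) atTop (𝓝 0)

/-!
Up to `ε`, an L-weakly compact set `S` lies in an order interval `[-u, u]` whose endpoint `u` is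
itself L-weakly compact. Otherwise one greedily picks `x n ∈ sol S` with `‖(|x n| - U n)⁺‖ > ε`,
where `U (n + 1) = 2 (U n + |x n|)`; the factor `2` makes these positive parts almost disjoint, and
removing a summable overlap makes them disjoint without losing their norm.

On `[0, u]` monotone sequences converge in norm. If no positive functional dominated the norm there
up to `ε`, one could greedily pick `z n ∈ [0, u]` and positive functionals `f n` norming `z n` such
that `∑ k, f i (z k) < ∞` for all `i`. Every `f i` then vanishes on the order upper limit `a` of the
`z k`, and so `‖z n‖ = f n (z n) ≤ f n ((⨆ k ≥ n, z k) - a) → 0`, a contradiction.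

The resulting estimate `‖x‖ ≤ g (|x| ⊓ u) + ε` turns uaw-convergence in `sol S` into norm
convergence. Conversely, a disjoint sequence is uaw-null, and a uaw-null sequence together with `0`
is uaw-compact.
-/

open LatticeOrderedAddCommGroup
open scoped Pointwise

section LatticeGroup

variable {E : Type*} [AddCommGroup E] [Lattice E]

theorem inf_eq_zero_of_le_of_le {a b c d : E} (h : c ⊓ d = 0) (ha : 0 ≤ a) (hb : 0 ≤ b)
    (hac : a ≤ c) (hbd : b ≤ d) : a ⊓ b = 0 :=
  le_antisymm (h ▸ inf_le_inf hac hbd) (le_inf ha hb)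

theorem pairwise_inf_eq_zero_of_le {ι : Type*} {x y : ι → E}
    (h : Pairwise fun i j => y i ⊓ y j = 0) (hx : ∀ i, 0 ≤ x i) (hxy : ∀ i, x i ≤ y i) :
    Pairwise fun i j => x i ⊓ x j = 0 :=
  fun i j hij => inf_eq_zero_of_le_of_le (h hij) (hx i) (hx j) (hxy i) (hxy j)

variable [IsOrderedAddMonoid E]

theorem mem_solidClosure_of_nonneg_of_le {S : Set E} {x y : E} (hx : x ∈ solidClosure S)
    (hy : 0 ≤ y) (hyx : y ≤ x) : y ∈ solidClosure S :=
  isSolid_solidClosure S hx (by rwa [abs_of_nonneg hy, abs_of_nonneg (hy.trans hyx)])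

theorem mem_solidClosure_singleton {u x : E} (hx : 0 ≤ x) (hxu : x ≤ u) :
    x ∈ solidClosure {u} :=
  ⟨u, rfl, by rwa [abs_of_nonneg hx, abs_of_nonneg (hx.trans hxu)]⟩

theorem inf_add_le_inf_add_inf {a b c : E} (ha : 0 ≤ a) (hb : 0 ≤ b) (hc : 0 ≤ c) :
    a ⊓ (b + c) ≤ a ⊓ b + a ⊓ c := by
  rw [← sub_le_iff_le_add', sub_inf]
  refine sup_le ((sub_nonpos.2 inf_le_left).trans (le_inf ha hc)) (le_inf ?_ ?_)
  · exact (sub_le_self _ hb).trans inf_le_left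
  · exact sub_le_iff_le_add'.2 inf_le_right

theorem abs_sub_inf_le_add (a b : E) {u : E} (hu : 0 ≤ u) :
    |a - b| ⊓ u ≤ |a| ⊓ u + |b| ⊓ u := by
  have h : |a - b| ≤ |a| + |b| := by simpa [sub_eq_add_neg] using abs_add_le a (-b)
  calc |a - b| ⊓ u ≤ u ⊓ (|a| + |b|) := by rw [inf_comm]; exact inf_le_inf_left _ h
    _ ≤ u ⊓ |a| + u ⊓ |b| := inf_add_le_inf_add_inf hu (abs_nonneg a) (abs_nonneg b)
    _ = |a| ⊓ u + |b| ⊓ u := by rw [inf_comm u, inf_comm u]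

theorem le_add_posPart_sub (a b : E) : a ≤ b + (a - b)⁺ :=
  sub_le_iff_le_add'.1 (le_posPart _)

theorem posPart_sub_le_self {a b : E} (ha : 0 ≤ a) (hb : 0 ≤ b) : (a - b)⁺ ≤ a :=
  sup_le (sub_le_self _ hb) ha

theorem posPart_sub_inf_posPart_sub_eq_zero (a b : E) : (a - b)⁺ ⊓ (b - a)⁺ = 0 := by
  rw [← neg_sub a b, posPart_neg, posPart_inf_negPart_eq_zero]

theorem inf_sum_eq_zero {ι : Type*} {s : Finset ι} {a : E} {y : ι → E} (ha : 0 ≤ a)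
    (hy : ∀ i ∈ s, 0 ≤ y i) (h : ∀ i ∈ s, a ⊓ y i = 0) : a ⊓ ∑ i ∈ s, y i = 0 := by
  classical
  induction s using Finset.induction_on with
  | empty => simpa using ha
  | insert i s hi ih =>
    simp only [Finset.forall_mem_insert] at hy h
    have hs : 0 ≤ ∑ j ∈ s, y j := Finset.sum_nonneg hy.2
    rw [Finset.sum_insert hi]
    refine le_antisymm ?_ (le_inf ha (add_nonneg hy.1 hs))
    calc a ⊓ (y i + ∑ j ∈ s, y j) ≤ a ⊓ y i + a ⊓ ∑ j ∈ s, y j :=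
          inf_add_le_inf_add_inf ha hy.1 hs
      _ = 0 := by rw [h.1, ih hy.2 h.2, add_zero]

theorem sum_le_of_pairwise_inf_eq_zero {ι : Type*} {w : E} {y : ι → E} (hw : 0 ≤ w)
    (hy : ∀ i, 0 ≤ y i) (hyw : ∀ i, y i ≤ w) (h : Pairwise fun i j => y i ⊓ y j = 0)
    (s : Finset ι) : ∑ i ∈ s, y i ≤ w := by
  classical
  induction s using Finset.induction_on with
  | empty => simpa using hw
  | insert i s hi ih =>
    have hdisj : y i ⊓ ∑ j ∈ s, y j = 0 :=
      inf_sum_eq_zero (hy i) (fun j _ => hy j) fun j hj => h (ne_of_mem_of_not_mem hj hi).symm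
    rw [Finset.sum_insert hi, ← inf_add_sup, hdisj, zero_add]
    exact sup_le (hyw i) ih

theorem partialSups_le_sum_range {y : ℕ → E} (hy : ∀ n, 0 ≤ y n) (N : ℕ) :
    partialSups y N ≤ ∑ i ∈ Finset.range (N + 1), y i :=
  partialSups_le _ _ _ fun _ hi =>
    Finset.single_le_sum (fun i _ => hy i) (Finset.mem_range_succ_iff.2 hi)

end LatticeGroup

section LatticeModule

variable {E : Type*} [AddCommGroup E] [Lattice E] [Module ℝ E] [IsOrderedModule ℝ E]

theorem smul_inf_of_pos {c : ℝ} (hc : 0 < c) (a b : E) : c • (a ⊓ b) = c • a ⊓ c • b :=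
  (OrderIso.smulRight hc).map_inf a b

theorem posPart_smul_of_pos {c : ℝ} (hc : 0 < c) (a : E) : (c • a)⁺ = c • a⁺ := by
  simpa only [posPart_def, OrderIso.smulRight_apply, smul_zero] using
    ((OrderIso.smulRight hc).map_sup a (0 : E)).symm

variable [IsOrderedAddMonoid E]

theorem inf_smul_eq_zero {c : ℝ} (hc : 1 ≤ c) {a b : E} (ha : 0 ≤ a) (hb : 0 ≤ b)
    (h : a ⊓ b = 0) : a ⊓ c • b = 0 := by
  have hc0 : 0 < c := one_pos.trans_le hc
  have hac : a ≤ c • a := by simpa using smul_le_smul_of_nonneg_right hc ha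
  refine inf_eq_zero_of_le_of_le ?_ ha (smul_nonneg hc0.le hb) hac le_rfl
  rw [← smul_inf_of_pos hc0, h, smul_zero]

theorem smul_inf_posPart_sub_smul_le {c : ℝ} (hc : 1 ≤ c) (p : E) {q : E} (hq : 0 ≤ q) :
    c • (p ⊓ (q - c • p)⁺) ≤ q := by
  have hc0 : 0 < c := one_pos.trans_le hc
  have hdisj : (c • p - q)⁺ ⊓ c • (q - c • p)⁺ = 0 :=
    inf_smul_eq_zero hc (posPart_nonneg _) (posPart_nonneg _)
      (posPart_sub_inf_posPart_sub_eq_zero _ _)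
  rw [← sub_nonpos, ← hdisj, smul_inf_of_pos hc0]
  exact le_inf ((sub_le_sub_right inf_le_left q).trans (le_posPart _))
    ((sub_le_self _ hq).trans inf_le_right)

theorem le_zero_of_forall_le_posPart_sub {ι : Type*} {s : Finset ι} (hs : s.Nonempty)
    {w : ι → E} {v : E} (hw : ∑ i ∈ s, w i ≤ (s.card : ℝ) • v) {b : E}
    (hb : ∀ i ∈ s, b ≤ (w i - v)⁺) : b ≤ 0 := by
  let _ : DistribLattice E := AddCommGroup.toDistribLattice E
  have hinf : s.inf' hs w ≤ v := by
    have hcard : (0 : ℝ) < s.card := by exact_mod_cast hs.card_pos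
    rw [← smul_le_smul_iff_of_pos_left hcard, Nat.cast_smul_eq_nsmul]
    exact (s.card_nsmul_le_sum _ _ fun i hi => Finset.inf'_le w hi).trans hw
  have hbv : v + b ≤ s.inf' hs w ⊔ v := by
    rw [Finset.inf'_sup_distrib_right]
    refine Finset.le_inf' _ _ fun i hi => ?_
    rw [sup_eq_add_posPart_sub]
    exact add_le_add_right (hb i hi) v
  rw [sup_eq_right.2 hinf] at hbv
  simpa using hbv

theorem two_pow_smul_le_of_recurrence {U x : ℕ → E} (hU0 : ∀ n, 0 ≤ U n) (hx : ∀ n, 0 ≤ x n)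
    (hU : ∀ n, U (n + 1) = (2 : ℝ) • (U n + x n)) (n k : ℕ) :
    (2 : ℝ) ^ (k + 1) • x n ≤ U (k + (n + 1)) := by
  induction k with
  | zero =>
    rw [zero_add, zero_add, pow_one, hU]
    exact smul_le_smul_of_nonneg_left (le_add_of_nonneg_left (hU0 n)) zero_le_two
  | succ k ih =>
    rw [add_right_comm k 1 (n + 1), hU, pow_succ', mul_smul]
    exact smul_le_smul_of_nonneg_left (ih.trans (le_add_of_nonneg_right (hx _))) zero_le_two

end LatticeModule

section Sequences

theorem exists_seq_of_forall_exists {α β : Type*} {P : α → Prop} {Q : α → β → Prop}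
    (step : α → β → α) {a : α} (ha : P a) (h : ∀ a, P a → ∃ b, Q a b ∧ P (step a b)) :
    ∃ (U : ℕ → α) (x : ℕ → β),
      (∀ n, P (U n)) ∧ (∀ n, Q (U n) (x n)) ∧ ∀ n, U (n + 1) = step (U n) (x n) := by
  choose next hQ hP using h
  let V : ℕ → {a // P a} := Nat.rec ⟨a, ha⟩ fun _ p => ⟨_, hP p.1 p.2⟩
  exact ⟨fun n => (V n).1, fun n => next _ (V n).2, fun n => (V n).2, fun n => hQ _ _,
    fun _ => rfl⟩

theorem exists_strictMono_forall_lt_le {d : ℕ → ℕ → ℝ}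
    (hd : ∀ n, Tendsto (d n) atTop (𝓝 0)) :
    ∃ φ : ℕ → ℕ, StrictMono φ ∧ ∀ i j, i < j → d (φ i) (φ j) ≤ (1 / 2) ^ i * (1 / 2) ^ j := by
  have hnext : ∀ n, ∃ m, n < m ∧ ∀ k ≤ n, d k m ≤ (1 / 2) ^ n * (1 / 2) ^ (n + 1) := fun n => by
    have hev : ∀ᶠ m in atTop, ∀ k ∈ Set.Iic n, d k m ≤ (1 / 2) ^ n * (1 / 2) ^ (n + 1) :=
      (Set.finite_Iic n).eventually_all.2 fun k _ =>
        (hd k).eventually_le_const (by positivity)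
    exact ((eventually_gt_atTop n).and hev).exists
  choose ψ hψ hdψ using hnext
  let φ : ℕ → ℕ := fun i => ψ^[i] 0
  have hφ : ∀ i, φ (i + 1) = ψ (φ i) := fun i => Function.iterate_succ_apply' ψ i 0
  have hmono : StrictMono φ := strictMono_nat_of_lt_succ fun i => by rw [hφ]; exact hψ _
  refine ⟨φ, hmono, fun i j hij => ?_⟩
  obtain ⟨j, rfl⟩ := Nat.exists_eq_add_one_of_ne_zero hij.ne_bot
  have hj : j ≤ φ j := hmono.le_apply
  have hij' : i ≤ j := Nat.lt_succ_iff.1 hij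
  calc d (φ i) (φ (j + 1)) ≤ (1 / 2) ^ φ j * (1 / 2) ^ (φ j + 1) := by
        rw [hφ]; exact hdψ _ _ (hmono.monotone hij')
    _ ≤ (1 / 2) ^ i * (1 / 2) ^ (j + 1) := by
        gcongr ?_ * ?_ <;>
          exact pow_le_pow_of_le_one (by norm_num) (by norm_num) (by omega)

end Sequences

section NormedLattice

variable {E : Type*} [NormedAddCommGroup E] [Lattice E] [HasSolidNorm E]

theorem isBounded_solidClosure {S : Set E} (hS : Bornology.IsBounded S) :
    Bornology.IsBounded (solidClosure S) := by
  obtain ⟨K, hK⟩ := hS.exists_norm_le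
  exact isBounded_iff_forall_norm_le.2 ⟨K, fun x ⟨y, hy, hxy⟩ =>
    (norm_le_norm_of_abs_le_abs hxy).trans (hK y hy)⟩

variable [IsOrderedAddMonoid E]

theorem norm_le_norm_of_nonneg_of_le {a b : E} (ha : 0 ≤ a) (hab : a ≤ b) : ‖a‖ ≤ ‖b‖ :=
  norm_le_norm_of_abs_le_abs (by rwa [abs_of_nonneg ha, abs_of_nonneg (ha.trans hab)])

theorem norm_posPart_le (a : E) : ‖a⁺‖ ≤ ‖a‖ := by
  rw [← norm_abs_eq_norm a]
  exact norm_le_norm_of_nonneg_of_le (posPart_nonneg a) (sup_le (le_abs_self a) (abs_nonneg a))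

theorem norm_posPart_add_le (a b : E) : ‖(a + b)⁺‖ ≤ ‖a⁺‖ + ‖b⁺‖ :=
  (norm_le_norm_of_nonneg_of_le (posPart_nonneg _) (sup_le
    (add_le_add (le_posPart a) (le_posPart b))
    (add_nonneg (posPart_nonneg a) (posPart_nonneg b)))).trans (norm_add_le _ _)

theorem exists_pairwise_inf_eq_zero_of_norm_inf_le [CompleteSpace E] {ι : Type*} {z : ι → E}
    (hz : ∀ i, 0 ≤ z i) {δ : ι → ℝ} {s : ℝ} (hδ0 : ∀ i, 0 ≤ δ i) (hδ : HasSum δ s)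
    (h : ∀ i j, i ≠ j → ‖z i ⊓ z j‖ ≤ δ i * δ j) :
    ∃ w : ι → E, (∀ i, 0 ≤ w i) ∧ (∀ i, w i ≤ z i) ∧ (Pairwise fun i j => w i ⊓ w j = 0) ∧
      ∀ i, ‖z i - w i‖ ≤ δ i * s := by
  classical
  let c : ι → ι → E := fun i j => if i = j then 0 else z i ⊓ z j
  have hc0 : ∀ i j, 0 ≤ c i j := fun i j => by
    by_cases hij : i = j <;> simp [c, hij, hz]
  have hc : ∀ i j, ‖c i j‖ ≤ δ i * δ j := fun i j => by
    by_cases hij : i = j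
    · simpa [c, hij] using mul_nonneg (hδ0 j) (hδ0 j)
    · simpa [c, hij] using h i j hij
  have hsum : ∀ i, HasSum (fun j => δ i * δ j) (δ i * s) := fun i => hδ.mul_left _
  let t : ι → E := fun i => ∑' j, c i j
  have ht0 : ∀ i, 0 ≤ t i := fun i => tsum_nonneg (hc0 i)
  have hle_t : ∀ i j, i ≠ j → z i ⊓ z j ≤ t i := fun i j hij => by
    have := ((hsum i).summable.of_norm_bounded (hc i)).le_tsum j fun k _ => hc0 i k
    simpa [c, hij] using this
  have hw_le : ∀ i j, i ≠ j → (z i - t i)⁺ ≤ (z i - z j)⁺ := fun i j hij => by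
    rw [← sub_sub_cancel (z i) (z i - z j)⁺, ← inf_eq_sub_posPart_sub]
    exact sup_le (sub_le_sub_left (hle_t i j hij) _) (sub_nonneg.2 inf_le_left)
  refine ⟨fun i => (z i - t i)⁺, fun i => posPart_nonneg _,
    fun i => posPart_sub_le_self (hz i) (ht0 i), fun i j hij => ?_, fun i => ?_⟩
  · exact inf_eq_zero_of_le_of_le (posPart_sub_inf_posPart_sub_eq_zero (z i) (z j))
      (posPart_nonneg _) (posPart_nonneg _) (hw_le i j hij) (hw_le j i hij.symm)
  · rw [← inf_eq_sub_posPart_sub]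
    exact (norm_le_norm_of_nonneg_of_le (le_inf (hz i) (ht0 i)) inf_le_right).trans
      (tsum_of_norm_bounded (hsum i) (hc i))

end NormedLattice

section NormedLatticeModule

variable {E : Type*} [NormedAddCommGroup E] [Lattice E] [IsOrderedAddMonoid E] [HasSolidNorm E]
  [NormedSpace ℝ E] [IsOrderedModule ℝ E]

theorem norm_inf_posPart_sub_le {c : ℝ} (hc : 1 ≤ c) {p q v y : E} (hy : 0 ≤ y) (hyp : y ≤ p)
    (hpv : c • p ≤ v) (hq : 0 ≤ q) : ‖y ⊓ (q - v)⁺‖ ≤ c⁻¹ * ‖q‖ := by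
  have hc0 : 0 < c := one_pos.trans_le hc
  have hnonneg : 0 ≤ y ⊓ (q - v)⁺ := le_inf hy (posPart_nonneg _)
  have hle : c • (y ⊓ (q - v)⁺) ≤ q :=
    (smul_le_smul_of_nonneg_left
      (inf_le_inf hyp (posPart_mono (sub_le_sub_left hpv q))) hc0.le).trans
      (smul_inf_posPart_sub_smul_le hc p hq)
  rw [le_inv_mul_iff₀ hc0]
  simpa only [norm_smul, Real.norm_of_nonneg hc0.le] using
    norm_le_norm_of_nonneg_of_le (smul_nonneg hc0.le hnonneg) hle

theorem exists_monotone_dual_eq_norm {x : E} (hx : 0 ≤ x) :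
    ∃ f : StrongDual ℝ E, Monotone f ∧ ‖f‖ ≤ 1 ∧ f x = ‖x‖ := by
  rcases eq_or_ne x 0 with rfl | hx0
  · exact ⟨0, monotone_const, by simp⟩
  -- Domination by `‖y⁺‖`, rather than by `‖y‖`, is what makes the extension positive.
  obtain ⟨g, hg, hg_le⟩ := exists_extension_of_le_sublinear
    (LinearPMap.mkSpanSingleton x ‖x‖ hx0) (fun y => ‖y⁺‖)
    (fun c hc y => by rw [posPart_smul_of_pos hc, norm_smul, Real.norm_of_nonneg hc.le])
    norm_posPart_add_le
    (by
      rintro ⟨y, hy⟩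
      obtain ⟨c, rfl⟩ := Submodule.mem_span_singleton.1 hy
      refine (LinearPMap.mkSpanSingleton'_apply x ‖x‖ _ c hy).trans_le ?_
      rcases le_total 0 c with hc | hc
      · rw [posPart_of_nonneg (smul_nonneg hc hx), norm_smul, Real.norm_of_nonneg hc]
        exact le_rfl
      · exact (mul_nonpos_of_nonpos_of_nonneg hc (norm_nonneg _)).trans (norm_nonneg _))
  have hbound : ∀ y, ‖g y‖ ≤ 1 * ‖y‖ := fun y => by
    rw [one_mul, Real.norm_eq_abs]
    refine abs_le'.2 ⟨(hg_le y).trans (norm_posPart_le y), ?_⟩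
    simpa only [map_neg, norm_neg] using (hg_le (-y)).trans (norm_posPart_le (-y))
  refine ⟨g.mkContinuous 1 hbound, (monotone_iff_map_nonneg _).2 fun y hy => ?_,
    g.mkContinuous_norm_le zero_le_one hbound, ?_⟩
  · have h := hg_le (-y)
    rw [posPart_of_nonpos (neg_nonpos.2 hy), norm_zero, map_neg] at h
    exact neg_nonpos.1 h
  · exact (hg ⟨x, Submodule.mem_span_singleton_self x⟩).trans
      (LinearPMap.mkSpanSingleton_apply _ _ hx0 _)

end NormedLatticeModule

namespace IsLWeaklyCompact

section Lattice

variable {E : Type u} [NormedAddCommGroup E] [Lattice E] {S T : Set E}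

theorem of_subset_solidClosure [HasSolidNorm E] (hS : IsLWeaklyCompact S)
    (hT : T ⊆ solidClosure S) : IsLWeaklyCompact T :=
  ⟨(isBounded_solidClosure hS.1).subset hT, fun x hx =>
    hS.2 x fun n => solidClosure_min hT (isSolid_solidClosure S) (hx n)⟩

variable [IsOrderedAddMonoid E]

theorem tendsto_norm_of_pairwise_inf_eq_zero (hS : IsLWeaklyCompact S) {x : ℕ → E}
    (hx : ∀ n, 0 ≤ x n) (hxS : ∀ n, x n ∈ solidClosure S)
    (hdisj : Pairwise fun m n => x m ⊓ x n = 0) : Tendsto (fun n => ‖x n‖) atTop (𝓝 0) :=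
  hS.2 x hxS fun m n hmn => by
    rw [abs_of_nonneg (hx m), abs_of_nonneg (hx n)]
    exact hdisj hmn

theorem singleton_zero : IsLWeaklyCompact ({0} : Set E) := by
  refine ⟨Bornology.isBounded_singleton, fun x hx _ => ?_⟩
  have hx0 : x = 0 := funext fun n => by
    obtain ⟨_, rfl, hxn⟩ := hx n
    rw [abs_zero] at hxn
    exact ((le_abs_self _).trans hxn).antisymm (neg_nonpos.1 ((neg_le_abs _).trans hxn))
  simp [hx0]

variable [HasSolidNorm E]

theorem add (hS : IsLWeaklyCompact S) (hT : IsLWeaklyCompact T) : IsLWeaklyCompact (S + T) := by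
  refine ⟨hS.1.add hT.1, fun x hx hdisj => ?_⟩
  have hsplit : ∀ n, ∃ s ∈ S, ∃ t ∈ T, |x n| ≤ |s| + |t| := fun n => by
    obtain ⟨_, ⟨s, hs, t, ht, rfl⟩, hxn⟩ := hx n
    exact ⟨s, hs, t, ht, hxn.trans (abs_add_le s t)⟩
  choose s hs t ht hst using hsplit
  have hp0 : ∀ n, 0 ≤ |x n| ⊓ |s n| := fun n => le_inf (abs_nonneg _) (abs_nonneg _)
  have hq0 : ∀ n, 0 ≤ (|x n| - |s n|)⁺ := fun n => posPart_nonneg _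
  have hp : Tendsto (fun n => ‖|x n| ⊓ |s n|‖) atTop (𝓝 0) :=
    hS.tendsto_norm_of_pairwise_inf_eq_zero hp0
      (fun n => ⟨s n, hs n, by rw [abs_of_nonneg (hp0 n)]; exact inf_le_right⟩)
      (pairwise_inf_eq_zero_of_le hdisj hp0 fun n => inf_le_left)
  have hq : Tendsto (fun n => ‖(|x n| - |s n|)⁺‖) atTop (𝓝 0) :=
    hT.tendsto_norm_of_pairwise_inf_eq_zero hq0
      (fun n => ⟨t n, ht n, by
        rw [abs_of_nonneg (hq0 n)]
        exact sup_le (sub_le_iff_le_add'.2 (hst n)) (abs_nonneg _)⟩)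
      (pairwise_inf_eq_zero_of_le hdisj hq0 fun n =>
        posPart_sub_le_self (abs_nonneg _) (abs_nonneg _))
  refine squeeze_zero (fun n => norm_nonneg _) (fun n => ?_) (by simpa using hp.add hq)
  calc ‖x n‖ = ‖|x n| ⊓ |s n| + (|x n| - |s n|)⁺‖ := by
        rw [inf_eq_sub_posPart_sub, sub_add_cancel, norm_abs_eq_norm]
    _ ≤ ‖|x n| ⊓ |s n|‖ + ‖(|x n| - |s n|)⁺‖ := norm_add_le _ _

theorem tendsto_norm_of_tendsto_norm_inf [CompleteSpace E] (hS : IsLWeaklyCompact S)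
    {y : ℕ → E} (hy : ∀ n, 0 ≤ y n) (hyS : ∀ n, y n ∈ solidClosure S)
    (h : ∀ n, Tendsto (fun m => ‖y n ⊓ y m‖) atTop (𝓝 0)) :
    Tendsto (fun n => ‖y n‖) atTop (𝓝 0) := by
  refine tendsto_of_subseq_tendsto fun ns hns => ?_
  obtain ⟨φ, -, hφ⟩ := exists_strictMono_forall_lt_le fun n => (h (ns n)).comp hns
  refine ⟨φ, ?_⟩
  obtain ⟨w, hw0, hwy, hdisj, hyw⟩ := exists_pairwise_inf_eq_zero_of_norm_inf_le
    (z := fun i => y (ns (φ i))) (δ := fun i => (1 / 2) ^ i) (fun i => hy _)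
    (fun i => by positivity) hasSum_geometric_two fun i j hij => by
      rcases hij.lt_or_gt with hlt | hlt
      · exact hφ i j hlt
      · rw [inf_comm, mul_comm]
        exact hφ j i hlt
  have hw : Tendsto (fun i => ‖w i‖) atTop (𝓝 0) :=
    hS.tendsto_norm_of_pairwise_inf_eq_zero hw0
      (fun i => mem_solidClosure_of_nonneg_of_le (hyS _) (hw0 i) (hwy i)) hdisj
  have hδ : Tendsto (fun i : ℕ => (1 / 2 : ℝ) ^ i * 2) atTop (𝓝 0) := by
    simpa using (tendsto_pow_atTop_nhds_zero_of_lt_one (r := (1 / 2 : ℝ)) (by norm_num)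
      (by norm_num)).mul_const 2
  refine squeeze_zero (fun i => norm_nonneg _) (fun i => ?_)
    (by simpa only [add_zero] using hδ.add hw)
  calc ‖y (ns (φ i))‖ = ‖(y (ns (φ i)) - w i) + w i‖ := by rw [sub_add_cancel]
    _ ≤ ‖y (ns (φ i)) - w i‖ + ‖w i‖ := norm_add_le _ _
    _ ≤ (1 / 2) ^ i * 2 + ‖w i‖ := add_le_add_left (hyw i) _

theorem tendsto_norm_of_forall_card_eq [CompleteSpace E] (hS : IsLWeaklyCompact S) (R : ℕ)
    {y : ℕ → E} (hy : ∀ n, 0 ≤ y n) (hyS : ∀ n, y n ∈ solidClosure S)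
    (h : ∀ s : Finset ℕ, s.card = R + 1 → ∀ b, (∀ i ∈ s, b ≤ y i) → b ≤ 0) :
    Tendsto (fun n => ‖y n‖) atTop (𝓝 0) := by
  induction R generalizing y with
  | zero =>
    have hy0 : y = 0 := funext fun n => (h {n} rfl (y n) (by simp)).antisymm (hy n)
    simp [hy0]
  | succ R ih =>
    refine hS.tendsto_norm_of_tendsto_norm_inf hy hyS fun n =>
      (tendsto_add_atTop_iff_nat (n + 1)).1 ?_
    have hinf : ∀ m, 0 ≤ y n ⊓ y (m + (n + 1)) := fun m => le_inf (hy _) (hy _)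
    refine ih hinf (fun m => mem_solidClosure_of_nonneg_of_le (hyS n) (hinf m) inf_le_left)
      fun s hs b hb => ?_
    obtain ⟨k, hk⟩ : s.Nonempty := Finset.card_pos.1 (hs ▸ R.succ_pos)
    have hn : n ∉ s.map (addRightEmbedding (n + 1)) := by
      simp only [Finset.mem_map, addRightEmbedding_apply, not_exists, not_and]
      omega
    refine h (insert n (s.map (addRightEmbedding (n + 1)))) ?_ b ?_
    · rw [Finset.card_insert_of_notMem hn, Finset.card_map, hs]
    · simp only [Finset.forall_mem_insert, Finset.forall_mem_map, addRightEmbedding_apply]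
      exact ⟨(hb k hk).trans inf_le_left, fun i hi => (hb i hi).trans inf_le_right⟩

end Lattice

section OrderInterval

variable {E : Type u} [NormedAddCommGroup E] [Lattice E] [IsOrderedAddMonoid E] [HasSolidNorm E]
  [NormedSpace ℝ E] [IsOrderedModule ℝ E] [CompleteSpace E] {u : E}

theorem tendsto_norm_of_sum_le (hu : IsLWeaklyCompact {u}) {w : ℕ → E} (hw : ∀ n, 0 ≤ w n)
    (hsum : ∀ N, ∑ i ∈ Finset.range N, w i ≤ u) : Tendsto (fun n => ‖w n‖) atTop (𝓝 0) := by
  have hu0 : 0 ≤ u := by simpa using hsum 0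
  have hsum' : ∀ s : Finset ℕ, ∑ i ∈ s, w i ≤ u := fun s =>
    (Finset.sum_le_sum_of_subset_of_nonneg s.subset_range_sup_succ fun i _ _ => hw i).trans
      (hsum _)
  refine Metric.tendsto_nhds.2 fun ε hε => ?_
  obtain ⟨R, hR⟩ := exists_nat_gt (2 * ‖u‖ / ε)
  have hR1 : (0 : ℝ) < (R + 1 : ℕ) := by positivity
  set v : E := ((R + 1 : ℕ) : ℝ)⁻¹ • u with hv
  have hv0 : 0 ≤ v := smul_nonneg (inv_nonneg.2 hR1.le) hu0
  -- `R + 1` of the elements `w i` with sum at most `u` cannot exceed `u / (R + 1)` simultaneously.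
  have hoverlap : Tendsto (fun n => ‖(w n - v)⁺‖) atTop (𝓝 0) := by
    refine hu.tendsto_norm_of_forall_card_eq R (fun n => posPart_nonneg _)
      (fun n => mem_solidClosure_singleton (posPart_nonneg _)
        ((posPart_sub_le_self (hw n) hv0).trans (by simpa using hsum' {n})))
      fun s hs b hb => ?_
    refine le_zero_of_forall_le_posPart_sub (Finset.card_pos.1 (hs ▸ R.succ_pos)) ?_ hb
    rw [hs, hv, smul_inv_smul₀ hR1.ne']
    exact hsum' s
  have hv_lt : ‖v‖ < ε / 2 := by
    rw [hv, norm_smul, norm_inv, Real.norm_of_nonneg hR1.le, inv_mul_lt_iff₀ hR1]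
    rw [div_lt_iff₀ hε] at hR
    push_cast
    linarith
  filter_upwards [hoverlap.eventually_lt_const (half_pos hε)] with n hn
  rw [dist_zero_right, norm_norm]
  calc ‖w n‖ ≤ ‖v + (w n - v)⁺‖ :=
        norm_le_norm_of_nonneg_of_le (hw n) (le_add_posPart_sub _ _)
    _ ≤ ‖v‖ + ‖(w n - v)⁺‖ := norm_add_le _ _
    _ < ε := by linarith

theorem cauchySeq_of_monotone (hu : IsLWeaklyCompact {u}) {x : ℕ → E} (hx : Monotone x)
    (hx0 : ∀ n, 0 ≤ x n) (hxu : ∀ n, x n ≤ u) : CauchySeq x := by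
  rw [Metric.cauchySeq_iff']
  by_contra! hcon
  obtain ⟨ε, hε, hfar⟩ := hcon
  obtain ⟨φ, hφ⟩ : ∃ φ : ℕ → ℕ, ∀ k, φ k ≤ φ (k + 1) ∧ ε ≤ dist (x (φ (k + 1))) (x (φ k)) := by
    choose ψ hψ using hfar
    exact ⟨fun k => ψ^[k] 0, fun k => by simpa only [Function.iterate_succ_apply'] using hψ _⟩
  have hnull := hu.tendsto_norm_of_sum_le (w := fun k => x (φ (k + 1)) - x (φ k))
    (fun k => sub_nonneg.2 (hx (hφ k).1)) fun N => by
      rw [Finset.sum_range_sub (fun k => x (φ k))]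
      exact (sub_le_self _ (hx0 _)).trans (hxu _)
  obtain ⟨k, hk⟩ := (hnull.eventually_lt_const hε).exists
  rw [← dist_eq_norm] at hk
  exact hk.not_ge (hφ k).2

theorem cauchySeq_of_antitone (hu : IsLWeaklyCompact {u}) {x : ℕ → E} (hx : Antitone x)
    (hx0 : ∀ n, 0 ≤ x n) (hxu : ∀ n, x n ≤ u) : CauchySeq x := by
  have h := hu.cauchySeq_of_monotone (x := fun n => u - x n)
    (fun m n hmn => sub_le_sub_left (hx hmn) u) (fun n => sub_nonneg.2 (hxu n))
    fun n => sub_le_self u (hx0 n)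
  simpa only [Pi.neg_def, neg_add_eq_sub, sub_sub_cancel_left, neg_neg] using
    (h.const_add (x := -u)).neg

theorem exists_tendsto_partialSups (hu : IsLWeaklyCompact {u}) {z : ℕ → E} (hz0 : ∀ n, 0 ≤ z n)
    (hzu : ∀ n, z n ≤ u) : ∃ (v : ℕ → E) (a : E),
      (∀ n, Tendsto (partialSups fun k => z (k + n)) atTop (𝓝 (v n))) ∧ Tendsto v atTop (𝓝 a) := by
  have hle : ∀ n N, partialSups (fun k => z (k + n)) N ≤ u := fun n N =>
    partialSups_le _ _ _ fun k _ => hzu _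
  choose v hv using fun n => cauchySeq_tendsto_of_complete <|
    hu.cauchySeq_of_monotone (partialSups fun k => z (k + n)).monotone
      (fun N => (hz0 _).trans (le_partialSups (fun k => z (k + n)) N)) (hle n)
  have hzv : ∀ n k, z (k + n) ≤ v n := fun n k =>
    (le_partialSups (fun k => z (k + n)) k).trans
      ((partialSups fun k => z (k + n)).monotone.ge_of_tendsto (hv n) k)
  have hv_anti : Antitone v := antitone_nat_of_succ_le fun n =>
    le_of_tendsto' (hv (n + 1)) fun N => partialSups_le _ _ _ fun k _ => by
      rw [← add_assoc, add_right_comm]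
      exact hzv n (k + 1)
  obtain ⟨a, ha⟩ := cauchySeq_tendsto_of_complete <|
    hu.cauchySeq_of_antitone hv_anti (fun n => (hz0 _).trans (hzv n 0))
      fun n => le_of_tendsto' (hv n) (hle n)
  exact ⟨v, a, hv, ha⟩

theorem tendsto_dual_diagonal (hu : IsLWeaklyCompact {u}) {z : ℕ → E} (hz0 : ∀ n, 0 ≤ z n)
    (hzu : ∀ n, z n ≤ u) {f : ℕ → StrongDual ℝ E} (hf : ∀ n, Monotone (f n))
    (hf1 : ∀ n, ‖f n‖ ≤ 1) (hfz : ∀ i, Summable fun k => f i (z k)) :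
    Tendsto (fun n => f n (z n)) atTop (𝓝 0) := by
  obtain ⟨v, a, hv, ha⟩ := hu.exists_tendsto_partialSups hz0 hzu
  have hf_nonneg : ∀ i k, 0 ≤ f i (z k) := fun i k => by simpa using hf i (hz0 k)
  have hfv : ∀ i n, f i (v n) ≤ ∑' k, f i (z (k + n)) := fun i n =>
    le_of_tendsto' (((f i).continuous.tendsto _).comp (hv n)) fun N =>
      calc f i (partialSups (fun k => z (k + n)) N)
          ≤ f i (∑ k ∈ Finset.range (N + 1), z (k + n)) :=
            hf i (partialSups_le_sum_range (fun k => hz0 _) N)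
        _ = ∑ k ∈ Finset.range (N + 1), f i (z (k + n)) := map_sum _ _ _
        _ ≤ ∑' k, f i (z (k + n)) :=
            ((summable_nat_add_iff n).2 (hfz i)).sum_le_tsum _ fun k _ => hf_nonneg i _
  have hfa : ∀ i, f i a ≤ 0 := fun i =>
    le_of_tendsto_of_tendsto' (((f i).continuous.tendsto a).comp ha)
      (tendsto_sum_nat_add fun k => f i (z k)) (hfv i)
  have hzv : ∀ n, z n ≤ v n := fun n => by
    simpa using (partialSups fun k => z (k + n)).monotone.ge_of_tendsto (hv n) 0
  refine squeeze_zero (fun n => hf_nonneg n n) (fun n => ?_)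
    (tendsto_iff_norm_sub_tendsto_zero.1 ha)
  calc f n (z n) ≤ f n (v n) := hf n (hzv n)
    _ = f n (v n - a) + f n a := by rw [map_sub, sub_add_cancel]
    _ ≤ f n (v n - a) := add_le_of_nonpos_right (hfa n)
    _ ≤ 1 * ‖v n - a‖ := (le_abs_self _).trans ((f n).le_of_opNorm_le (hf1 n) _)
    _ = ‖v n - a‖ := one_mul _

theorem exists_dual_norm_le (hu : IsLWeaklyCompact {u}) {ε : ℝ} (hε : 0 < ε) :
    ∃ g : StrongDual ℝ E, Monotone g ∧ ∀ z, 0 ≤ z → z ≤ u → ‖z‖ ≤ g z + ε := by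
  by_contra! hcon
  obtain ⟨G, x, hG, hx, hGx⟩ := exists_seq_of_forall_exists
    (P := fun g : StrongDual ℝ E => Monotone g)
    (Q := fun g (x : E × StrongDual ℝ E) => (0 ≤ x.1 ∧ x.1 ≤ u ∧ g x.1 + ε < ‖x.1‖) ∧
      Monotone x.2 ∧ ‖x.2‖ ≤ 1 ∧ x.2 x.1 = ‖x.1‖)
    (fun g x => (2 : ℝ) • (g + x.2)) (a := 0) monotone_const fun g hg => by
      obtain ⟨z, hz0, hzu, hz⟩ := hcon g hg
      obtain ⟨f, hf, hf1, hfz⟩ := exists_monotone_dual_eq_norm hz0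
      exact ⟨(z, f), ⟨⟨hz0, hzu, hz⟩, hf, hf1, hfz⟩,
        fun a b hab => mul_le_mul_of_nonneg_left (add_le_add (hg hab) (hf hab)) zero_le_two⟩
  simp only [forall_and] at hx
  obtain ⟨⟨hz0, hzu, hz⟩, hf, hf1, hfz⟩ := hx
  have hG0 : ∀ n {y}, 0 ≤ y → 0 ≤ G n y := fun n y hy => by simpa using hG n hy
  have hf0 : ∀ n {y}, 0 ≤ y → 0 ≤ (x n).2 y := fun n y hy => by simpa using hf n hy
  have hdecay : ∀ i k, (x i).2 (x (k + (i + 1))).1 ≤ ‖u‖ / 2 * (1 / 2) ^ k := fun i k => by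
    have hgrowth := two_pow_smul_le_of_recurrence (U := fun n => G n (x (k + (i + 1))).1)
      (x := fun n => (x n).2 (x (k + (i + 1))).1) (fun n => hG0 n (hz0 _))
      (fun n => hf0 n (hz0 _)) (fun n => by rw [hGx]; rfl) i k
    have hbound : G (k + (i + 1)) (x (k + (i + 1))).1 ≤ ‖u‖ := by
      linarith [hz (k + (i + 1)), norm_le_norm_of_nonneg_of_le (hz0 (k + (i + 1))) (hzu _)]
    rw [one_div_pow, mul_one_div, le_div_iff₀ (by positivity), le_div_iff₀ zero_lt_two]
    rw [smul_eq_mul, pow_succ] at hgrowth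
    linarith
  have hsummable : ∀ i, Summable fun k => (x i).2 (x k).1 := fun i =>
    (summable_nat_add_iff (i + 1)).1 <|
      (summable_geometric_two.mul_left _).of_nonneg_of_le (fun k => hf0 i (hz0 _)) (hdecay i)
  obtain ⟨n, hn⟩ := ((hu.tendsto_dual_diagonal hz0 hzu hf hf1 hsummable).eventually_lt_const
    hε).exists
  linarith [hfz n, hz n, hG0 n (hz0 n)]

end OrderInterval

section Functionals

variable {E : Type u} [NormedAddCommGroup E] [Lattice E] [IsOrderedAddMonoid E] [HasSolidNorm E]
  [NormedSpace ℝ E] [IsOrderedModule ℝ E] [CompleteSpace E] {S : Set E}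

theorem exists_norm_posPart_le (hS : IsLWeaklyCompact S) {ε : ℝ} (hε : 0 < ε) :
    ∃ u : E, 0 ≤ u ∧ IsLWeaklyCompact {u} ∧ ∀ x ∈ solidClosure S, ‖(|x| - u)⁺‖ ≤ ε := by
  by_contra! hcon
  obtain ⟨U, x, hU, hx, hUx⟩ := exists_seq_of_forall_exists
    (P := fun u : E => 0 ≤ u ∧ IsLWeaklyCompact {u})
    (Q := fun u x => x ∈ solidClosure S ∧ ε < ‖(|x| - u)⁺‖)
    (fun u x => (2 : ℝ) • (u + |x|)) ⟨le_rfl, singleton_zero⟩ fun u ⟨hu0, hu⟩ => by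
      obtain ⟨x, hxS, hx⟩ := hcon u hu0 hu
      have hx' : IsLWeaklyCompact {|x|} := hS.of_subset_solidClosure <|
        Set.singleton_subset_iff.2 (isSolid_solidClosure S hxS (abs_abs x).le)
      refine ⟨x, ⟨hxS, hx⟩, smul_nonneg zero_le_two (add_nonneg hu0 (abs_nonneg x)), ?_⟩
      simpa only [two_smul, Set.singleton_add_singleton] using (hu.add hx').add (hu.add hx')
  simp only [forall_and] at hU hx
  obtain ⟨⟨hU0, -⟩, hxS, hx⟩ := And.intro hU hx
  obtain ⟨K, hK⟩ := (isBounded_solidClosure hS.1).exists_norm_le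
  have hnull : Tendsto (fun n => ‖(|x n| - U n)⁺‖) atTop (𝓝 0) := by
    have hle : ∀ n, (|x n| - U n)⁺ ≤ |x n| := fun n =>
      posPart_sub_le_self (abs_nonneg _) (hU0 n)
    refine hS.tendsto_norm_of_tendsto_norm_inf (fun n => posPart_nonneg _)
      (fun n => isSolid_solidClosure S (hxS n) (by
        rw [abs_of_nonneg (posPart_nonneg _)]
        exact hle n))
      fun n => (tendsto_add_atTop_iff_nat (n + 1)).1 ?_
    have hlim : Tendsto (fun k : ℕ => ((2 : ℝ) ^ (k + 1))⁻¹ * K) atTop (𝓝 0) := by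
      have hpow : Tendsto (fun k : ℕ => (2 : ℝ) ^ (k + 1)) atTop atTop :=
        (tendsto_pow_atTop_atTop_of_one_lt one_lt_two).comp (tendsto_add_atTop_nat 1)
      simpa only [zero_mul, Pi.inv_def] using hpow.inv_tendsto_atTop.mul_const K
    refine squeeze_zero (fun k => norm_nonneg _) (fun k => ?_) hlim
    refine (norm_inf_posPart_sub_le (one_le_pow₀ one_le_two) (posPart_nonneg _) (hle n)
      (two_pow_smul_le_of_recurrence hU0 (fun n => abs_nonneg (x n)) hUx n k)
      (abs_nonneg _)).trans ?_
    rw [norm_abs_eq_norm]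
    exact mul_le_mul_of_nonneg_left (hK _ (hxS _)) (by positivity)
  obtain ⟨n, hn⟩ := (hnull.eventually_lt_const hε).exists
  exact hn.not_gt (hx n)

theorem exists_dual_norm_le_inf_add (hS : IsLWeaklyCompact S) {ε : ℝ} (hε : 0 < ε) :
    ∃ g : StrongDual ℝ E, Monotone g ∧ ∃ u : E, 0 ≤ u ∧
      ∀ x ∈ solidClosure S, ‖x‖ ≤ g (|x| ⊓ u) + ε := by
  obtain ⟨u, hu0, hu, hSu⟩ := hS.exists_norm_posPart_le (half_pos hε)
  obtain ⟨g, hg, hgu⟩ := hu.exists_dual_norm_le (half_pos hε)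
  refine ⟨g, hg, u, hu0, fun x hx => ?_⟩
  calc ‖x‖ = ‖|x| ⊓ u + (|x| - u)⁺‖ := by
        rw [inf_eq_sub_posPart_sub, sub_add_cancel, norm_abs_eq_norm]
    _ ≤ ‖|x| ⊓ u‖ + ‖(|x| - u)⁺‖ := norm_add_le _ _
    _ ≤ (g (|x| ⊓ u) + ε / 2) + ε / 2 :=
        add_le_add (hgu _ (le_inf (abs_nonneg x) hu0) inf_le_right) (hSu x hx)
    _ = g (|x| ⊓ u) + ε := by ring

end Functionals

end IsLWeaklyCompact

section Nets

theorem tendsto_subtype_val_atTop_of_frequently {ι : Type*} [Preorder ι] [IsDirectedOrder ι]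
    [Nonempty ι] {p : ι → Prop} (h : ∃ᶠ i in atTop, p i) :
    IsDirectedOrder {i // p i} ∧ Nonempty {i // p i} ∧
      Tendsto (Subtype.val : {i // p i} → ι) atTop atTop := by
  have hex : ∀ i : ι, ∃ j : {i // p i}, i ≤ (j : ι) := fun i => by
    obtain ⟨j, hij, hj⟩ := frequently_atTop.1 h i
    exact ⟨⟨j, hj⟩, hij⟩
  refine ⟨⟨fun i j => ?_⟩, (hex (Classical.arbitrary ι)).nonempty, tendsto_atTop.2 fun i => ?_⟩
  · obtain ⟨k, hik, hjk⟩ := exists_ge_ge (i : ι) j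
    obtain ⟨m, hkm⟩ := hex k
    exact ⟨m, hik.trans hkm, hjk.trans hkm⟩
  · obtain ⟨j, hij⟩ := hex i
    have := (hex i).nonempty
    exact (eventually_ge_atTop j).mono fun k hk => hij.trans hk

theorem exists_tendsto_atTop_eventuallyEq_comp {ι X : Type*} {l : Filter ι} {y : ℕ → X} {x : ι → X}
    (hx : ∀ᶠ i in l, x i ∈ Set.range y) (hne : ∀ n, ∀ᶠ i in l, x i ≠ y n) :
    ∃ n : ι → ℕ, Tendsto n l atTop ∧ x =ᶠ[l] y ∘ n := by
  have hex : ∀ i, ∃ n, x i ∈ Set.range y → x i = y n := fun i => by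
    by_cases hi : x i ∈ Set.range y
    · exact ⟨hi.choose, fun _ => hi.choose_spec.symm⟩
    · exact ⟨0, fun h => absurd h hi⟩
  choose n hn using hex
  refine ⟨n, ?_, hx.mono hn⟩
  rw [← Nat.cofinite_eq_atTop]
  refine le_cofinite_iff_eventually_ne.2 fun k => eventually_map.2 ?_
  filter_upwards [hx, hne k] with i hi hik hnk
  exact hik (hnk ▸ hn i hi)

theorem tendsto_down_atTop : Tendsto (ULift.down : ULift.{v} ℕ → ℕ) atTop atTop :=
  tendsto_atTop.2 fun n => eventually_ge_atTop (ULift.up n)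

theorem tendsto_up_atTop : Tendsto (ULift.up : ℕ → ULift.{v} ℕ) atTop atTop :=
  tendsto_atTop.2 fun n => eventually_ge_atTop n.down

theorem exists_subseq_of_subnet {X : Type*} [TopologicalSpace X] [FirstCountableTopology X]
    {x : ℕ → X} {κ : Type*} [Preorder κ] [IsDirectedOrder κ] [Nonempty κ]
    {φ : κ → ULift.{v} ℕ} (hφ : Tendsto φ atTop atTop) {a : X}
    (h : Tendsto (fun k => x (φ k).down) atTop (𝓝 a)) :
    ∃ ψ : ℕ → ℕ, StrictMono ψ ∧ Tendsto (x ∘ ψ) atTop (𝓝 a) :=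
  (h.mapClusterPt.of_comp (tendsto_down_atTop.comp hφ)).tendsto_subseq

theorem isCompact_closure_of_forall_seq {X : Type*} [PseudoMetricSpace X] {A : Set X}
    (h : ∀ x : ℕ → X, (∀ n, x n ∈ A) →
      ∃ a, ∃ φ : ℕ → ℕ, StrictMono φ ∧ Tendsto (x ∘ φ) atTop (𝓝 a)) : IsCompact (closure A) := by
  refine IsSeqCompact.isCompact fun y hy => ?_
  have happrox : ∀ n : ℕ, ∃ z ∈ A, dist (y n) z < 1 / (n + 1 : ℝ) := fun n =>
    Metric.mem_closure_iff.1 (hy n) _ Nat.one_div_pos_of_nat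
  choose z hzA hz using happrox
  obtain ⟨a, φ, hφ, ha⟩ := h z hzA
  refine ⟨a, mem_closure_of_tendsto ha (.of_forall fun _ => hzA _), φ, hφ, ?_⟩
  exact (tendsto_iff_of_dist (squeeze_zero (fun _ => dist_nonneg) (fun n => (hz (φ n)).le)
    (tendsto_one_div_add_atTop_nhds_zero_nat.comp hφ.tendsto_atTop))).2 ha

end Nets

section Uaw

variable {E : Type u} [NormedAddCommGroup E] [NormedSpace ℝ E] [Lattice E] {ι : Type v}
  {l : Filter ι} {x : ι → E} {a : E}

theorem uawTendsto_iff :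
    UawTendsto l x a ↔ ∀ w : E, 0 ≤ w → ∀ f : StrongDual ℝ E,
      Tendsto (fun i => f (|x i - a| ⊓ w)) l (𝓝 0) := by
  have hinj : Function.Injective (topDualPairing ℝ E).flip := fun x y h =>
    (SeparatingDual.eq_iff_forall_dual_eq (R := ℝ)).2 fun f => DFunLike.congr_fun h f
  refine forall₂_congr fun w _ =>
    (WeakBilin.tendsto_iff_forall_eval_tendsto _ hinj).trans (forall_congr' fun f => ?_)
  have h : (topDualPairing ℝ E).flip 0 f = 0 := map_zero f
  exact Iff.of_eq (congrArg (fun t => Tendsto _ l (𝓝 t)) h)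

namespace UawTendsto

theorem comp {κ : Type*} {k : Filter κ} {φ : κ → ι} (h : UawTendsto l x a) (hφ : Tendsto φ k l) :
    UawTendsto k (x ∘ φ) a :=
  fun w hw => (h w hw).comp hφ

theorem congr' {y : ι → E} (h : UawTendsto l x a) (hxy : x =ᶠ[l] y) : UawTendsto l y a :=
  fun w hw => (h w hw).congr' (hxy.mono fun i hi => by rw [hi])

theorem tendsto_zero_of_forall_norm_le (h : UawTendsto l x 0)
    (hx : ∀ ε : ℝ, 0 < ε → ∃ (g : StrongDual ℝ E) (w : E), 0 ≤ w ∧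
      ∀ i, ‖x i‖ ≤ g (|x i| ⊓ w) + ε) : Tendsto x l (𝓝 0) := by
  refine Metric.tendsto_nhds.2 fun ε hε => ?_
  obtain ⟨g, w, hw, hg⟩ := hx (ε / 2) (half_pos hε)
  have hlim := uawTendsto_iff.1 h w hw g
  simp only [sub_zero] at hlim
  filter_upwards [hlim.eventually_lt_const (half_pos hε)] with i hi
  rw [dist_zero_right]
  linarith [hg i]

end UawTendsto

variable [IsOrderedAddMonoid E]

theorem uawTendsto_const (l : Filter ι) (a : E) : UawTendsto l (fun _ => a) a := fun w hw => by
  simpa only [sub_self, abs_zero, inf_eq_left.2 hw, map_zero] using tendsto_const_nhds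

variable [HasSolidNorm E]

theorem UawTendsto.eq_of_tendsto {b : E} [l.NeBot] (ha : UawTendsto l x a)
    (hb : Tendsto x l (𝓝 b)) : a = b := by
  have hsub : Tendsto (fun i => x i - a) l (𝓝 (b - a)) := hb.sub_const a
  have habs : Tendsto (fun i => |x i - a| ⊓ |b - a|) l (𝓝 |b - a|) := by
    have habs_sub : Tendsto (fun i => |x i - a|) l (𝓝 |b - a|) := hsub.sup_nhds hsub.neg
    simpa only [inf_idem] using habs_sub.inf_nhds (tendsto_const_nhds (x := |b - a|))
  have hzero : |b - a| = 0 :=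
    (SeparatingDual.eq_zero_iff_forall_dual_eq_zero (R := ℝ) _).2 fun f => tendsto_nhds_unique
      ((f.continuous.tendsto _).comp habs) (uawTendsto_iff.1 ha _ (abs_nonneg _) f)
  rw [← sub_eq_zero, ← norm_eq_zero, norm_sub_rev, ← norm_abs_eq_norm, hzero, norm_zero]

theorem summable_abs_dual_of_sum_le {y : ι → E} (hy : ∀ i, 0 ≤ y i) {w : E}
    (hw : ∀ s : Finset ι, ∑ i ∈ s, y i ≤ w) (f : StrongDual ℝ E) :
    Summable fun i => |f (y i)| := by
  have hsign : ∀ i, ∃ t, |t| = y i ∧ f t = |f (y i)| := fun i => by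
    rcases abs_choice (f (y i)) with h | h
    · exact ⟨y i, abs_of_nonneg (hy i), h.symm⟩
    · exact ⟨-y i, by rw [abs_neg, abs_of_nonneg (hy i)], by rw [map_neg, h]⟩
  choose t ht hft using hsign
  have ht_le : ∀ s : Finset ι, |∑ i ∈ s, t i| ≤ |w| := fun s =>
    calc |∑ i ∈ s, t i| ≤ ∑ i ∈ s, |t i| :=
          Finset.le_sum_of_subadditive (fun x : E => |x|) abs_zero.le abs_add_le _ _
      _ = ∑ i ∈ s, y i := Finset.sum_congr rfl fun i _ => ht i
      _ ≤ |w| := (hw s).trans (le_abs_self w)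
  refine summable_of_sum_le (c := ‖f‖ * ‖w‖) (fun i => abs_nonneg _) fun s => ?_
  calc ∑ i ∈ s, |f (y i)| = f (∑ i ∈ s, t i) := by simp only [map_sum, hft]
    _ ≤ ‖f‖ * ‖∑ i ∈ s, t i‖ := (le_abs_self _).trans (f.le_opNorm _)
    _ ≤ ‖f‖ * ‖w‖ :=
        mul_le_mul_of_nonneg_left (norm_le_norm_of_abs_le_abs (ht_le s)) (norm_nonneg f)

theorem uawTendsto_zero_of_pairwise_inf_eq_zero {x : ℕ → E}
    (h : Pairwise fun m n => |x m| ⊓ |x n| = 0) : UawTendsto atTop x 0 := by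
  refine uawTendsto_iff.2 fun w hw f => ?_
  have hnonneg : ∀ n, 0 ≤ |x n| ⊓ w := fun n => le_inf (abs_nonneg _) hw
  have hsum : ∀ s : Finset ℕ, ∑ n ∈ s, |x n| ⊓ w ≤ w :=
    sum_le_of_pairwise_inf_eq_zero hw hnonneg (fun n => inf_le_right)
      (pairwise_inf_eq_zero_of_le h hnonneg fun n => inf_le_left)
  simp only [sub_zero]
  exact (tendsto_zero_iff_abs_tendsto_zero _).2
    (summable_abs_dual_of_sum_le hnonneg hsum f).tendsto_atTop_zero

end Uaw

section UawCompact

variable {E : Type u} [NormedAddCommGroup E] [NormedSpace ℝ E] [Lattice E] {A S : Set E}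

theorem IsUawCompact.isRelativelyUawCompact (hA : IsUawCompact A) : IsRelativelyUawCompact A :=
  fun ι _ _ _ x hx => by
    obtain ⟨κ, i₁, i₂, i₃, φ, hφ, a, -, ha⟩ := hA ι x hx
    exact ⟨κ, i₁, i₂, i₃, φ, hφ, a, ha⟩

variable [IsOrderedAddMonoid E]

theorem isUawCompact_insert_range {y : ℕ → E} (hy : UawTendsto atTop y 0) :
    IsUawCompact (insert 0 (Set.range y)) := by
  intro ι _ _ _ x hx
  by_cases hfreq : ∃ a ∈ insert 0 (Set.range y), ∃ᶠ i in atTop, x i = a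
  · obtain ⟨a, ha, hxa⟩ := hfreq
    obtain ⟨hdir, hne, hval⟩ := tendsto_subtype_val_atTop_of_frequently hxa
    refine ⟨{i // x i = a}, inferInstance, hdir, hne, Subtype.val, hval, a, ha, ?_⟩
    exact (uawTendsto_const atTop a).congr' (.of_forall fun i => i.2.symm)
  · have hne : ∀ a ∈ insert 0 (Set.range y), ∀ᶠ i in atTop, x i ≠ a := fun a ha =>
      not_frequently.1 fun h => hfreq ⟨a, ha, h⟩
    have hrange : ∀ᶠ i in atTop, x i ∈ Set.range y :=
      (hne 0 (Set.mem_insert _ _)).mono fun i hi => (hx i).resolve_left hi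
    obtain ⟨n, hn, hxn⟩ := exists_tendsto_atTop_eventuallyEq_comp hrange fun n =>
      hne _ (Set.mem_insert_of_mem _ (Set.mem_range_self n))
    exact ⟨ι, inferInstance, inferInstance, inferInstance, id, tendsto_id, 0,
      Set.mem_insert _ _, (hy.comp hn).congr' hxn.symm⟩

variable [HasSolidNorm E]

theorem isLWeaklyCompact_of_forall_uawTendsto_zero (hS : Bornology.IsBounded S)
    (h : ∀ x : ℕ → E, (∀ n, x n ∈ solidClosure S) → UawTendsto atTop x 0 →
      Tendsto x atTop (𝓝 0)) : IsLWeaklyCompact S :=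
  ⟨hS, fun x hx hdisj => tendsto_zero_iff_norm_tendsto_zero.1 <|
    h x hx (uawTendsto_zero_of_pairwise_inf_eq_zero fun _ _ hmn => hdisj _ _ hmn)⟩

theorem isLWeaklyCompact_of_forall_net_uawTendsto_zero (hS : Bornology.IsBounded S)
    (h : ∀ (ι : Type v) [Preorder ι] [IsDirectedOrder ι] [Nonempty ι] (x : ι → E),
      (∀ i, x i ∈ solidClosure S) → UawTendsto atTop x 0 → Tendsto x atTop (𝓝 0)) :
    IsLWeaklyCompact S :=
  isLWeaklyCompact_of_forall_uawTendsto_zero hS fun x hx hx0 =>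
    (h (ULift.{v} ℕ) (x ∘ ULift.down) (fun _ => hx _) (hx0.comp tendsto_down_atTop)).comp
      tendsto_up_atTop

theorem isLWeaklyCompact_of_forall_isUawCompact (hS : Bornology.IsBounded S)
    (h : ∀ B ⊆ solidClosure S, Bornology.IsBounded B → IsUawCompact B → IsCompact (closure B)) :
    IsLWeaklyCompact S := by
  refine isLWeaklyCompact_of_forall_uawTendsto_zero hS fun x hx hx0 =>
    tendsto_of_subseq_tendsto fun ns hns => ?_
  have hxns : UawTendsto atTop (x ∘ ns) 0 := hx0.comp hns
  have hsub : insert 0 (Set.range (x ∘ ns)) ⊆ solidClosure S :=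
    Set.insert_subset (isSolid_solidClosure S (hx 0) (by rw [abs_zero]; exact abs_nonneg _))
      (Set.range_subset_iff.2 fun _ => hx _)
  obtain ⟨a, -, φ, hφ, ha⟩ :=
    (h _ hsub ((isBounded_solidClosure hS).subset hsub)
      (isUawCompact_insert_range hxns)).tendsto_subseq (x := x ∘ ns)
      fun n => subset_closure (Set.mem_insert_of_mem _ (Set.mem_range_self n))
  obtain rfl : 0 = a := (hxns.comp hφ.tendsto_atTop).eq_of_tendsto ha
  exact ⟨φ, ha⟩

namespace IsLWeaklyCompact

variable [IsOrderedModule ℝ E] [CompleteSpace E]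

-- The differences `x i - x j` lie in `sol S + sol S`, so that uaw-convergent nets are Cauchy even
-- though the limit need not lie in `sol S`.
theorem tendsto_of_uawTendsto (hS : IsLWeaklyCompact S) {ι : Type*} {l : Filter ι} [l.NeBot]
    {x : ι → E} {a : E} (hx : ∀ i, x i ∈ solidClosure S) (h : UawTendsto l x a) :
    Tendsto x l (𝓝 a) := by
  have hdiff : IsLWeaklyCompact (solidClosure S + solidClosure S) :=
    have hsol := hS.of_subset_solidClosure subset_rfl
    hsol.add hsol
  have hmem : ∀ i j, x i - x j ∈ solidClosure (solidClosure S + solidClosure S) := fun i j =>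
    ⟨x i - x j, sub_eq_add_neg (x i) (x j) ▸ Set.add_mem_add (hx i)
      (isSolid_solidClosure S (hx j) (abs_neg (x j)).le), le_rfl⟩
  have hcauchy : Cauchy (map x l) := by
    refine Metric.cauchy_iff.2 ⟨inferInstance, fun ε hε => ?_⟩
    obtain ⟨g, hg, w, hw, hgw⟩ := hdiff.exists_dual_norm_le_inf_add (ε := ε / 3) (by positivity)
    have hsmall : ∀ᶠ i in l, g (|x i - a| ⊓ w) < ε / 3 :=
      (uawTendsto_iff.1 h w hw g).eventually_lt_const (by positivity)
    refine ⟨_, image_mem_map hsmall, ?_⟩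
    rintro _ ⟨i, hi : g _ < _, rfl⟩ _ ⟨j, hj : g _ < _, rfl⟩
    have hle : |x i - x j| ⊓ w ≤ |x i - a| ⊓ w + |x j - a| ⊓ w := by
      simpa only [sub_sub_sub_cancel_right] using abs_sub_inf_le_add (x i - a) (x j - a) hw
    calc dist (x i) (x j) = ‖x i - x j‖ := dist_eq_norm _ _
      _ ≤ g (|x i - x j| ⊓ w) + ε / 3 := hgw _ (hmem i j)
      _ ≤ (g (|x i - a| ⊓ w) + g (|x j - a| ⊓ w)) + ε / 3 := by
          rw [← map_add]
          exact add_le_add_left (hg hle) _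
      _ < ε := by linarith
  obtain ⟨b, hb⟩ := CompleteSpace.complete hcauchy
  obtain rfl : a = b := h.eq_of_tendsto hb
  exact hb

theorem isCompact_of_isUawCompact (hS : IsLWeaklyCompact S) (hAS : A ⊆ solidClosure S)
    (hA : IsUawCompact A) : IsCompact A := by
  refine IsSeqCompact.isCompact fun x hx => ?_
  obtain ⟨κ, _, _, _, φ, hφ, a, ha, hlim⟩ := hA (ULift.{u} ℕ) (fun n => x n.down) fun _ => hx _
  exact ⟨a, ha, exists_subseq_of_subnet hφ
    (hS.tendsto_of_uawTendsto (fun _ => hAS (hx _)) hlim)⟩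

theorem isCompact_closure_of_isRelativelyUawCompact (hS : IsLWeaklyCompact S)
    (hAS : A ⊆ solidClosure S) (hA : IsRelativelyUawCompact A) : IsCompact (closure A) := by
  refine isCompact_closure_of_forall_seq fun x hx => ?_
  obtain ⟨κ, _, _, _, φ, hφ, a, hlim⟩ := hA (ULift.{u} ℕ) (fun n => x n.down) fun _ => hx _
  exact ⟨a, exists_subseq_of_subnet hφ (hS.tendsto_of_uawTendsto (fun _ => hAS (hx _)) hlim)⟩

end IsLWeaklyCompact

end UawCompact

theorem corollary3p11 {E : Type u} [NormedAddCommGroup E] [NormedSpace ℝ E] [CompleteSpace E]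
    [Lattice E] [IsOrderedAddMonoid E] [IsOrderedModule ℝ E] [HasSolidNorm E]
    (S : Set E) (hS : Bornology.IsBounded S) :
    List.TFAE [
      IsLWeaklyCompact S,
      ∀ ε : ℝ, 0 < ε → ∃ g : StrongDual ℝ E, (∀ x : E, 0 ≤ x → 0 ≤ g x) ∧
        ∃ u : E, 0 ≤ u ∧
          ∀ x ∈ LatticeOrderedAddCommGroup.solidClosure S, ‖x‖ ≤ g (|x| ⊓ u) + ε,
      ∀ (ι : Type v) [Preorder ι] [IsDirectedOrder ι] [Nonempty ι] (x : ι → E),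
        (∀ i, x i ∈ LatticeOrderedAddCommGroup.solidClosure S) →
          UawTendsto atTop x 0 → Tendsto x atTop (𝓝 0),
      ∀ A : Set E, A ⊆ LatticeOrderedAddCommGroup.solidClosure S →
        Bornology.IsBounded A → IsUawCompact A → IsCompact A,
      ∀ A : Set E, A ⊆ LatticeOrderedAddCommGroup.solidClosure S →
        Bornology.IsBounded A → IsRelativelyUawCompact A → IsCompact (closure A)] := by
  tfae_have 1 → 2 := fun h ε hε => by
    obtain ⟨g, hg, hgu⟩ := h.exists_dual_norm_le_inf_add hε
    exact ⟨g, (monotone_iff_map_nonneg g).1 hg, hgu⟩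
  tfae_have 2 → 3 := fun h ι _ _ _ x hx hx0 =>
    hx0.tendsto_zero_of_forall_norm_le fun ε hε => by
      obtain ⟨g, -, u, hu, hgu⟩ := h ε hε
      exact ⟨g, u, hu, fun i => hgu _ (hx i)⟩
  tfae_have 3 → 1 := isLWeaklyCompact_of_forall_net_uawTendsto_zero hS
  tfae_have 1 → 4 := fun h A hA _ => h.isCompact_of_isUawCompact hA
  tfae_have 4 → 1 := fun h => isLWeaklyCompact_of_forall_isUawCompact hS
    fun B hBS hB hBc => (h B hBS hB hBc).closure
  tfae_have 1 → 5 := fun h A hA _ => h.isCompact_closure_of_isRelativelyUawCompact hA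
  tfae_have 5 → 1 := fun h => isLWeaklyCompact_of_forall_isUawCompact hS
    fun B hBS hB hBc => h B hBS hB hBc.isRelativelyUawCompact
  tfae_finish
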